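/- Let $G=(V,E)$ be a finite directed graph (loops and multiple edges allowed) in which every vertex $w$ has out-degree $d_w\ge 2$. A directed path is a sequence of one or more consecutive directed edges, and a directed circuit is a directed path that ends at its initial vertex. Let $L$ be a directed circuit, $u$ a vertex that $L$ does not go through, and $v$ a vertex that $L$ goes through, and suppose that there is a directed path from $u$ to $v$. To each edge $e\in E$, with initial vertex $\alpha(e)$ and terminal vertex $\omega(e)$, let there be assigned a contracting similarity $S_e(x)=\rho_e x+b_e$ of $\mathbb R$, $\rho_e\in(-1,1)\setminus\{0\}$. Suppose that this graph-directed IFS satisfies the convex open set condition (COSC): there are non-empty bounded open convex sets $U_w\subset\mathbb R$ $(w\in V)$ such that, for each $w$, the sets $S_e(U_{\omega(e)})$ with $\alpha(e)=w$ are pairwise disjoint subsets of $U_w$. Let $(F_w)_{w\in V}$ be its attractors, i.e. the unique non-empty compact sets with $F_w=\bigcup_{\alpha(e)=w}S_e(F_{\omega(e)})$ for all $w\in V$. For each $w\in V$ rank the edges $e$ leaving $w$ so that the intervals $S_e(\mathrm{conv}\,F_{\omega(e)})$ (whose interiors are disjoint by the COSC) run from left to right. For $1\le k\le d_w-1$ let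 $\lambda_w^{(k)}\ge 0$ be the length of the (possibly empty) open interval between the $k$-th and the $(k+1)$-st of these intervals, and let $\Lambda_w=\{\lambda_w^{(k)}:\lambda_w^{(k)}>0,\ 1\le k\le d_w-1\}$. Let $A(L)$ (resp. $A(L^c)$) be the set of the numbers $|\rho_e|$ for the edges $e$ in $L$ (resp. not in $L$). For a finite set $A=\{a_1,\dots,a_n\}\subset(0,\infty)$ of $n$ distinct numbers let $A^{\mathbb Q^*}$ (resp. $A^{\mathbb Q_+^*}$) be the set of all products $\prod_{i=1}^n a_i^{q_i}$ with $(q_i)$ a non-zero vector of rationals (resp. of nonnegative rationals), and let $A^{\mathbb Q}=\{1\}\cup A^{\mathbb Q^*}$. Suppose that (i) $(A(L))^{\mathbb Q^*}\cap (A(L^c))^{\mathbb Q_+^*}=\emptyset$; (ii) $\Lambda_u\ne\emptyset$ and $\Lambda_v\ne\emptyset$; (iii) for all pairs $(w,k)\ne(z,m)$ with $w,z\in V$, $1\le k\le d_w-1$, $1\le m\le d_z-1$ and $\lambda_z^{(m)}\neq 0$, we have $\lambda_w^{(k)}/\lambda_z^{(m)}\notin (A(L)\cup A(L^c))^{\mathbb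 Q}$. Then $F_u$ is not the attractor of any standard IFS satisfying the COSC; that is, there is no finite set $I$ of distinct contracting similarities $S(x)=\rho x+b$ of $\mathbb R$, $\rho\in(-1,1)\setminus\{0\}$, such that $F_u=\bigcup_{S\in I}S(F_u)$ and such that for some non-empty open convex set $U\subset\mathbb R$ the sets $S(U)$ $(S\in I)$ are pairwise disjoint subsets of $U$. -/

import Mathlib

/-- A directed graph with vertex set `V` and edge set `E`; loops and multiple edges are allowed. -/
structure DirectedMultigraph (V E : Type*) where
  /-- the initial vertex of an edge -/
  src : E → V
  /-- the terminal vertex of an edge -/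
  tgt : E → V

namespace DirectedMultigraph

variable {V E : Type*} (G : DirectedMultigraph V E)

/-- The out-degree of a vertex: the number of edges leaving it. -/
noncomputable def outDegree (u : V) : ℕ := Nat.card {e : E // G.src e = u}

/-- `G.Traverses u p v`: the consecutive edges of the list `p` lead from `u` to `v`
(for the empty list this means `u = v`). -/
def Traverses : V → List E → V → Prop
  | u, [], v => u = v
  | u, e :: p, v => G.src e = u ∧ Traverses (G.tgt e) p v

/-- A directed path from `u` to `v`; it has at least one edge. -/
def IsDirectedPath (u : V) (p : List E) (v : V) : Prop := p ≠ [] ∧ G.Traverses u p v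

/-- A directed circuit: a directed path that returns to its initial vertex. -/
def IsCircuit (L : List E) : Prop := ∃ a : V, G.IsDirectedPath a L a

/-- The edge list `L` goes through the vertex `w`. -/
def GoesThrough (L : List E) (w : V) : Prop := ∃ e ∈ L, G.src e = w ∨ G.tgt e = w

end DirectedMultigraph

/-- A contracting similarity `x ↦ ρ x + b` of the real line, `ρ ∈ (-1, 1) \ {0}`. -/
@[ext]
structure ContractingSimilarity where
  /-- the contraction ratio `ρ` -/
  ratio : ℝ
  /-- the translation part `b` -/
  shift : ℝ
  ratio_ne_zero : ratio ≠ 0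
  abs_ratio_lt_one : |ratio| < 1

/-- The map `x ↦ ρ x + b`. -/
def ContractingSimilarity.map (S : ContractingSimilarity) (x : ℝ) : ℝ := S.ratio * x + S.shift

/-- A standard iterated function system on `ℝ`: a finite set of distinct contracting
similarities. -/
abbrev StandardIFS := Finset ContractingSimilarity

namespace StandardIFS

/-- `K` is the attractor of the standard IFS `I`. -/
def IsAttractor (I : StandardIFS) (K : Set ℝ) : Prop :=
  K.Nonempty ∧ IsCompact K ∧ K = ⋃ S ∈ I, S.map '' K

/-- The convex open set condition for a standard IFS. -/
def COSC (I : StandardIFS) : Prop :=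
  ∃ U : Set ℝ, U.Nonempty ∧ IsOpen U ∧ Convex ℝ U ∧ (∀ S ∈ I, S.map '' U ⊆ U) ∧
    ∀ S ∈ I, ∀ T ∈ I, S ≠ T → Disjoint (S.map '' U) (T.map '' U)

end StandardIFS

/-- A graph-directed iterated function system on `ℝ` based on the digraph `G`: one contracting
similarity for each edge `e`, acting from the copy of `ℝ` at the terminal vertex of `e` to the
copy of `ℝ` at its initial vertex. -/
structure GraphDirectedIFS {V E : Type*} (G : DirectedMultigraph V E) where
  /-- the similarity of an edge -/
  sim : E → ContractingSimilarity

namespace GraphDirectedIFS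

variable {V E : Type*} {G : DirectedMultigraph V E} (S : GraphDirectedIFS G)

/-- `F` is the list of attractors of the graph-directed IFS. -/
def IsAttractor (F : V → Set ℝ) : Prop :=
  (∀ u, (F u).Nonempty) ∧ (∀ u, IsCompact (F u)) ∧
    ∀ u, F u = ⋃ e ∈ {e : E | G.src e = u}, (S.sim e).map '' F (G.tgt e)

/-- The convex open set condition for a graph-directed IFS. -/
def COSC : Prop :=
  ∃ U : V → Set ℝ,
    (∀ u, (U u).Nonempty ∧ Bornology.IsBounded (U u) ∧ IsOpen (U u) ∧ Convex ℝ (U u)) ∧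
    (∀ e, (S.sim e).map '' U (G.tgt e) ⊆ U (G.src e)) ∧
    ∀ e f, G.src e = G.src f → e ≠ f →
      Disjoint ((S.sim e).map '' U (G.tgt e)) ((S.sim f).map '' U (G.tgt f))

/-- For a set `s` of edges, the set `{|ρ_e| : e ∈ s}` of absolute contraction ratios. -/
noncomputable def absRatios [Finite E] (s : Set E) : Finset ℝ :=
  (Set.toFinite ((fun e => |(S.sim e).ratio|) '' s)).toFinset

variable (F : V → Set ℝ)

/-- The compact interval `S_e (conv F_{ω(e)})`, where `ω(e)` is the terminal vertex of `e`. -/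
def edgeInterval (e : E) : Set ℝ := (S.sim e).map '' convexHull ℝ (F (G.tgt e))

/-- The `k`-th edge leaving `u` (counted from `0`), where the edges `e` leaving `u` are ranked so
that the intervals `S_e (conv F_{ω(e)})` run from left to right. Under the convex open set
condition these intervals have disjoint non-empty interiors, so their left endpoints are distinct
and there is exactly one such ranking. -/
noncomputable def rankedEdge [Finite E] (u : V) : Fin (G.outDegree u) ≃ {e : E // G.src e = u} :=
  (Tuple.sort fun i : Fin (G.outDegree u) =>
      sInf (S.edgeInterval F ((Finite.equivFin {e : E // G.src e = u}).symm i))).trans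
    (Finite.equivFin {e : E // G.src e = u}).symm

theorem rankedEdge_monotone [Finite E] (u : V) :
    Monotone fun k => sInf (S.edgeInterval F (S.rankedEdge F u k)) :=
  Tuple.monotone_sort fun i : Fin (G.outDegree u) =>
    sInf (S.edgeInterval F ((Finite.equivFin {e : E // G.src e = u}).symm i))

/-- The length of the `k`-th basic gap at `u` (counted from `0`), that is of the open interval
between the `k`-th and the `(k+1)`-st of the ranked intervals at `u`. -/
noncomputable def basicGap [Finite E] (u : V) (k : Fin (G.outDegree u - 1)) : ℝ :=
  sInf (S.edgeInterval F (S.rankedEdge F u ⟨k + 1, by omega⟩)) -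
    sSup (S.edgeInterval F (S.rankedEdge F u ⟨k, by omega⟩))

/-- The set `Λ_u` of the strictly positive basic gap lengths at `u`. -/
def positiveGaps [Finite E] (u : V) : Set ℝ := {t | 0 < t ∧ ∃ k, S.basicGap F u k = t}

end GraphDirectedIFS

/-- `A^{ℚ*}`: products of the elements of `A` with rational exponents, not all zero. -/
def ratPowersStar (A : Finset ℝ) : Set ℝ :=
  {x | ∃ q : ℝ → ℚ, (∃ a ∈ A, q a ≠ 0) ∧ x = ∏ a ∈ A, a ^ (q a : ℝ)}

/-- `A^{ℚ₊*}`: products of the elements of `A` with nonnegative rational exponents, not all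
zero. -/
def nonnegRatPowersStar (A : Finset ℝ) : Set ℝ :=
  {x | ∃ q : ℝ → ℚ, (∀ a ∈ A, 0 ≤ q a) ∧ (∃ a ∈ A, q a ≠ 0) ∧ x = ∏ a ∈ A, a ^ (q a : ℝ)}

/-- `A^ℚ = {1} ∪ A^{ℚ*}`. -/
def ratPowers (A : Finset ℝ) : Set ℝ := {1} ∪ ratPowersStar A

/-! The invariant is the set of gap lengths of `F u`. Under the COSC the pieces of an attractor are
non-overlapping intervals' worth of points, so edge maps send gaps to gaps, and every gap is the
image of a positive basic gap along a path (`exists_path_of_mem_gapLengths`). A standard IFS is the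
one-vertex case, so both facts hold for it too.

Suppose a standard IFS with COSC generates `F u`, and let `r` be the absolute ratio of one of its
maps. Iterating that map on a basic gap at `u` and using the incommensurability of basic gaps shows
that `r` is the weight of a closed path at `u` (`exists_loop_weight`). Such a path starts with an
edge outside `L`, so `r` is an element of A(L)^ℚ times one of A(Lᶜ)^{ℚ₊*}.

On the other hand, a gap at `v` carried `n` times round `L` and then to `u` gives a geometric
sequence of gap lengths of `F u` with ratio the weight of `L`. Writing these through the standard
IFS and applying Dickson's lemma (`exists_lt_color_eq_count_le`), some positive power of that weight
is a product of ratios `r`. This is excluded by (i) (`disjoint_ratPowers_mixedPowers`). -/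

namespace ContractingSimilarity

variable (T : ContractingSimilarity)

theorem abs_ratio_pos : 0 < |T.ratio| := abs_pos.mpr T.ratio_ne_zero

theorem map_sub_map (x y : ℝ) : T.map x - T.map y = T.ratio * (x - y) := by
  simp only [map]; ring

theorem continuous_map : Continuous T.map := by
  unfold map; fun_prop

theorem isOpen_image {U : Set ℝ} (hU : IsOpen U) : IsOpen (T.map '' U) :=
  ((Homeomorph.mulLeft₀ T.ratio T.ratio_ne_zero).trans
    (Homeomorph.addRight T.shift)).isOpenMap U hU

theorem map_le_map_of_pos (h : 0 < T.ratio) {x y : ℝ} : T.map x ≤ T.map y ↔ x ≤ y := by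
  simp only [map, add_le_add_iff_right]
  exact mul_le_mul_iff_right₀ h

theorem map_le_map_of_neg (h : T.ratio < 0) {x y : ℝ} : T.map x ≤ T.map y ↔ y ≤ x := by
  simp only [map, add_le_add_iff_right]
  exact mul_le_mul_left_of_neg h

theorem map_injective : Function.Injective T.map := fun x y h => by
  have := T.map_sub_map x y
  rw [h, sub_self] at this
  have := (mul_eq_zero.mp this.symm).resolve_left T.ratio_ne_zero
  linarith

theorem dist_map (x y : ℝ) : dist (T.map x) (T.map y) = |T.ratio| * dist x y := by
  rw [Real.dist_eq, map_sub_map, abs_mul, Real.dist_eq]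

end ContractingSimilarity

/-! ### Gaps of a set and their images under similarities. -/

/-- The open interval `(a, b)` is a gap of `K`: it misses `K` and its endpoints lie in `K`. -/
def IsGap (K : Set ℝ) (a b : ℝ) : Prop := a ∈ K ∧ b ∈ K ∧ a < b ∧ ∀ x ∈ K, x ≤ a ∨ b ≤ x

/-- The lengths of the gaps of `K`. -/
def gapLengths (K : Set ℝ) : Set ℝ := {t | ∃ a b, IsGap K a b ∧ t = b - a}

theorem gapLengths_pos {K : Set ℝ} {t : ℝ} (h : t ∈ gapLengths K) : 0 < t := by
  obtain ⟨a, b, h, rfl⟩ := h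
  exact sub_pos.mpr h.2.2.1

theorem isGap_image_of_pos (T : ContractingSimilarity) (h : 0 < T.ratio) {K : Set ℝ} {a b : ℝ} :
    IsGap (T.map '' K) (T.map a) (T.map b) ↔ IsGap K a b := by
  simp only [IsGap, T.map_injective.mem_set_image, Set.forall_mem_image, T.map_le_map_of_pos h,
    ← not_le]

theorem isGap_image_of_neg (T : ContractingSimilarity) (h : T.ratio < 0) {K : Set ℝ} {a b : ℝ} :
    IsGap (T.map '' K) (T.map b) (T.map a) ↔ IsGap K a b := by
  simp only [IsGap, T.map_injective.mem_set_image, Set.forall_mem_image, T.map_le_map_of_neg h,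
    ← not_le]
  constructor
  · rintro ⟨hb, ha, h, h'⟩
    exact ⟨ha, hb, h, fun x hx => (h' hx).symm⟩
  · rintro ⟨ha, hb, h, h'⟩
    exact ⟨hb, ha, h, fun x hx => (h' x hx).symm⟩

theorem mul_mem_gapLengths_image (T : ContractingSimilarity) {K : Set ℝ} {t : ℝ}
    (ht : t ∈ gapLengths K) : |T.ratio| * t ∈ gapLengths (T.map '' K) := by
  obtain ⟨a, b, h, rfl⟩ := ht
  rcases T.ratio_ne_zero.lt_or_gt with hr | hr
  · refine ⟨T.map b, T.map a, (isGap_image_of_neg T hr).2 h, ?_⟩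
    rw [T.map_sub_map, abs_of_neg hr]; ring
  · refine ⟨T.map a, T.map b, (isGap_image_of_pos T hr).2 h, ?_⟩
    rw [T.map_sub_map, abs_of_pos hr]

theorem exists_of_mem_gapLengths_image (T : ContractingSimilarity) {K : Set ℝ} {t : ℝ}
    (ht : t ∈ gapLengths (T.map '' K)) : ∃ s ∈ gapLengths K, t = |T.ratio| * s := by
  obtain ⟨a, b, h, rfl⟩ := ht
  obtain ⟨a, ha, rfl⟩ := h.1
  obtain ⟨b, hb, rfl⟩ := h.2.1
  rcases T.ratio_ne_zero.lt_or_gt with hr | hr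
  · refine ⟨_, ⟨b, a, (isGap_image_of_neg T hr).1 h, rfl⟩, ?_⟩
    rw [T.map_sub_map, abs_of_neg hr]; ring
  · refine ⟨_, ⟨a, b, (isGap_image_of_pos T hr).1 h, rfl⟩, ?_⟩
    rw [T.map_sub_map, abs_of_pos hr]

/-! ### Gaps of a union of pieces arranged from left to right. -/

section OrderedFamily

variable {n : ℕ} {P : Fin n → Set ℝ} {lo hi : Fin n → ℝ}

theorem isGap_iUnion_of_isGap (hlo : ∀ i, IsLeast (P i) (lo i))
    (hhi : ∀ i, IsGreatest (P i) (hi i)) (hord : ∀ i j, i < j → hi i ≤ lo j)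
    {i : Fin n} {a b : ℝ} (h : IsGap (P i) a b) : IsGap (⋃ i, P i) a b := by
  refine ⟨Set.mem_iUnion.2 ⟨i, h.1⟩, Set.mem_iUnion.2 ⟨i, h.2.1⟩, h.2.2.1, fun x hx => ?_⟩
  obtain ⟨j, hj⟩ := Set.mem_iUnion.1 hx
  rcases lt_trichotomy i j with hij | rfl | hij
  · exact Or.inr (((hhi i).2 h.2.1).trans ((hord i j hij).trans ((hlo j).2 hj)))
  · exact h.2.2.2 x hj
  · exact Or.inl (((hhi j).2 hj).trans ((hord j i hij).trans ((hlo i).2 h.1)))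

theorem isGap_iUnion_of_lt (hlo : ∀ i, IsLeast (P i) (lo i))
    (hhi : ∀ i, IsGreatest (P i) (hi i)) (hord : ∀ i j, i < j → hi i ≤ lo j)
    {i j : Fin n} (hij : (j : ℕ) = i + 1) (h : hi i < lo j) :
    IsGap (⋃ i, P i) (hi i) (lo j) := by
  refine ⟨Set.mem_iUnion.2 ⟨i, (hhi i).1⟩, Set.mem_iUnion.2 ⟨j, (hlo j).1⟩, h, fun x hx => ?_⟩
  obtain ⟨l, hl⟩ := Set.mem_iUnion.1 hx
  have hle (i : Fin n) : lo i ≤ hi i := (hlo i).2 (hhi i).1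
  rcases lt_trichotomy l i with h1 | rfl | h1
  · exact Or.inl (((hhi l).2 hl).trans ((hord l i h1).trans (hle i)))
  · exact Or.inl ((hhi l).2 hl)
  · have h2 : j ≤ l := Fin.le_def.2 (by have := Fin.lt_def.1 h1; omega)
    rcases h2.eq_or_lt with rfl | h2
    · exact Or.inr ((hlo j).2 hl)
    · exact Or.inr ((hle j).trans ((hord j l h2).trans ((hlo l).2 hl)))

/-- Neighbouring pieces may share an endpoint, so the pieces first found to contain `a` and `b` need
not be the right ones. Testing the gap against the extreme points of piece `i` and its successor
either moves both endpoints into one piece or identifies them with facing extremes; by `hlt` no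
whole piece fits at a single point in between. -/
theorem IsGap.of_iUnion (hlo : ∀ i, IsLeast (P i) (lo i))
    (hhi : ∀ i, IsGreatest (P i) (hi i)) (hord : ∀ i j, i < j → hi i ≤ lo j)
    (hlt : ∀ i, lo i < hi i) {a b : ℝ} (h : IsGap (⋃ i, P i) a b) :
    (∃ i, IsGap (P i) a b) ∨ ∃ i j : Fin n, (j : ℕ) = i + 1 ∧ a = hi i ∧ b = lo j := by
  obtain ⟨ha, hb, hab, hgap⟩ := h
  have key (i : Fin n) (ha : a ∈ P i) (hb : b ∈ P i) : ∃ i, IsGap (P i) a b :=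
    ⟨i, ha, hb, hab, fun x hx => hgap x (Set.mem_iUnion.2 ⟨i, hx⟩)⟩
  have hL (i : Fin n) := hgap _ (Set.mem_iUnion.2 ⟨i, (hlo i).1⟩)
  have hH (i : Fin n) := hgap _ (Set.mem_iUnion.2 ⟨i, (hhi i).1⟩)
  obtain ⟨i, ha⟩ := Set.mem_iUnion.1 ha
  obtain ⟨j, hb⟩ := Set.mem_iUnion.1 hb
  have hai := (hhi i).2 ha
  have hbj := (hlo j).2 hb
  rcases lt_trichotomy i j with hij | rfl | hij
  · have h1 := hord i j hij
    rcases hH i with h2 | h2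
    · have hin : (i : ℕ) + 1 < n := by have := Fin.lt_def.1 hij; omega
      obtain ⟨l, hl⟩ : ∃ l : Fin n, (l : ℕ) = i + 1 := ⟨⟨i + 1, hin⟩, rfl⟩
      have hil : i < l := Fin.lt_def.2 (by omega)
      have hlj : l ≤ j := Fin.le_def.2 (by have := Fin.lt_def.1 hij; omega)
      have h3 := hord i l hil
      rcases hlj.eq_or_lt with rfl | hlj
      · rcases hL l with h4 | h4
        · refine Or.inl (key l ?_ hb)
          have : a = lo l := by linarith
          exact this ▸ (hlo l).1
        · exact Or.inr ⟨i, l, hl, by linarith, by linarith⟩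
      · have h5 := hord l j hlj
        have h6 := hlt l
        rcases hL l with h4 | h4
        · refine Or.inl (key l ?_ ?_)
          · have : a = lo l := by linarith
            exact this ▸ (hlo l).1
          · have : b = hi l := by rcases hH l with h7 | h7 <;> linarith
            exact this ▸ (hhi l).1
        · exact Or.inr ⟨i, l, hl, by linarith, by linarith⟩
    · refine Or.inl (key i ha ?_)
      have : b = hi i := by linarith
      exact this ▸ (hhi i).1
  · exact Or.inl (key i ha hb)
  · have h1 := hord j i hij
    have h2 := (hhi j).2 hb
    have h3 := (hlo i).2 ha
    linarith

end OrderedFamily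

/-! ### Convex open sets: location, non-degeneracy and order of the pieces. -/

theorem lt_or_gt_of_disjoint_ordConnected {A B : Set ℝ} (hA : A.OrdConnected)
    (hB : B.OrdConnected) (h : Disjoint A B) :
    (∀ x ∈ A, ∀ y ∈ B, x < y) ∨ ∀ x ∈ A, ∀ y ∈ B, y < x := by
  have hne {x y : ℝ} (hx : x ∈ A) (hy : y ∈ B) : x ≠ y := fun e =>
    Set.disjoint_left.1 h hx (e ▸ hy)
  by_contra! hcon
  obtain ⟨⟨p, hp, q, hq, hqp⟩, p', hp', q', hq', hpq'⟩ := hcon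
  have h1 : q < p := hqp.lt_of_ne (hne hp hq).symm
  have h2 : p' < q' := hpq'.lt_of_ne (hne hp' hq')
  rcases le_total p' q with h3 | h3
  · exact hne (hA.out hp' hp ⟨h3, h1.le⟩) hq rfl
  · exact hne hp' (hB.out hq hq' ⟨h3, h2.le⟩) rfl

namespace GraphDirectedIFS

variable {V E : Type*} {G : DirectedMultigraph V E} {S : GraphDirectedIFS G}
  {U F : V → Set ℝ}

/-- The sets `U w` witness the convex open set condition, except that they may be unbounded. -/
structure IsConvexOpenWitness (S : GraphDirectedIFS G) (U : V → Set ℝ) : Prop where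
  nonempty : ∀ w, (U w).Nonempty
  isOpen : ∀ w, IsOpen (U w)
  convex : ∀ w, Convex ℝ (U w)
  image_subset : ∀ e, (S.sim e).map '' U (G.tgt e) ⊆ U (G.src e)
  disjoint : ∀ e f, G.src e = G.src f → e ≠ f →
    Disjoint ((S.sim e).map '' U (G.tgt e)) ((S.sim f).map '' U (G.tgt f))

theorem IsAttractor.map_mem (hF : S.IsAttractor F) (e : E) {x : ℝ} (hx : x ∈ F (G.tgt e)) :
    (S.sim e).map x ∈ F (G.src e) := by
  rw [hF.2.2 (G.src e)]
  exact Set.mem_biUnion (show e ∈ {f | G.src f = G.src e} from rfl) (Set.mem_image_of_mem _ hx)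

theorem IsAttractor.exists_map_eq (hF : S.IsAttractor F) {w : V} {x : ℝ} (hx : x ∈ F w) :
    ∃ e, G.src e = w ∧ ∃ y ∈ F (G.tgt e), (S.sim e).map y = x := by
  rw [hF.2.2 w] at hx
  obtain ⟨e, he, y, hy, h⟩ := Set.mem_iUnion₂.1 hx
  exact ⟨e, he, y, hy, h⟩

/-- A common bound below one for the contraction ratios. -/
theorem exists_ratio_bound [Finite E] (S : GraphDirectedIFS G) :
    ∃ c, 0 < c ∧ c < 1 ∧ ∀ e, |(S.sim e).ratio| ≤ c := by
  cases nonempty_fintype E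
  rcases isEmpty_or_nonempty E with h | h
  · exact ⟨1 / 2, by norm_num, by norm_num, fun e => h.elim e⟩
  · obtain ⟨e, he⟩ := Finite.exists_max fun e => |(S.sim e).ratio|
    exact ⟨_, (S.sim e).abs_ratio_pos, (S.sim e).abs_ratio_lt_one, he⟩

/-- The largest distance from a point of `F w` to `U w` is finite by compactness, and passing
through an edge multiplies it by at most `c < 1`, so it vanishes. Boundedness of `U` plays no role,
which matters for standard systems. -/
theorem IsAttractor.subset_closure [Finite V] [Finite E] (hF : S.IsAttractor F)
    (hU : S.IsConvexOpenWitness U) (w : V) : F w ⊆ closure (U w) := by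
  obtain ⟨c, hc0, hc1, hc⟩ := S.exists_ratio_bound
  have hmax (w : V) : ∃ M, ∀ x ∈ F w, Metric.infDist x (U w) ≤ M := by
    obtain ⟨x, -, hx⟩ := (hF.2.1 w).exists_isMaxOn (hF.1 w)
      (Metric.continuous_infDist_pt (U w)).continuousOn
    exact ⟨_, fun y hy => hx hy⟩
  choose M hM using hmax
  cases nonempty_fintype V
  obtain ⟨D, hD⟩ : ∃ D, ∀ w, M w ≤ D := by
    obtain ⟨D, hD⟩ := (Set.finite_range M).bddAbove
    exact ⟨D, fun w => hD ⟨w, rfl⟩⟩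
  have step (n : ℕ) : ∀ w, ∀ x ∈ F w, Metric.infDist x (U w) ≤ c ^ n * D := by
    induction n with
    | zero => intro w x hx; simpa using (hM w x hx).trans (hD w)
    | succ n ih =>
      intro w x hx
      obtain ⟨e, rfl, y, hy, rfl⟩ := hF.exists_map_eq hx
      have h1 := ih _ y hy
      have h2 : Metric.infDist ((S.sim e).map y) (U (G.src e)) ≤
          |(S.sim e).ratio| * Metric.infDist y (U (G.tgt e)) := by
        rw [← div_le_iff₀' (S.sim e).abs_ratio_pos]
        refine (Metric.le_infDist (hU.nonempty _)).2 fun z hz => ?_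
        rw [div_le_iff₀' (S.sim e).abs_ratio_pos, ← (S.sim e).dist_map]
        exact Metric.infDist_le_dist_of_mem (hU.image_subset e ⟨z, hz, rfl⟩)
      calc _ ≤ _ := h2
        _ ≤ c * (c ^ n * D) :=
          mul_le_mul (hc e) h1 Metric.infDist_nonneg hc0.le
        _ = _ := by ring
  intro x hx
  rw [Metric.mem_closure_iff_infDist_zero (hU.nonempty w)]
  refine le_antisymm ?_ Metric.infDist_nonneg
  have : Filter.Tendsto (fun n : ℕ => c ^ n * D) Filter.atTop (nhds (0 * D)) :=
    (tendsto_pow_atTop_nhds_zero_of_lt_one hc0.le hc1).mul_const D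
  rw [zero_mul] at this
  exact ge_of_tendsto' this fun n => step n w x hx

theorem IsConvexOpenWitness.lt_or_gt (hU : S.IsConvexOpenWitness U) {e f : E}
    (hs : G.src e = G.src f) (hef : e ≠ f) :
    (∀ x ∈ (S.sim e).map '' U (G.tgt e), ∀ y ∈ (S.sim f).map '' U (G.tgt f), x < y) ∨
      ∀ x ∈ (S.sim e).map '' U (G.tgt e), ∀ y ∈ (S.sim f).map '' U (G.tgt f), y < x := by
  have hc (e : E) : ((S.sim e).map '' U (G.tgt e)).OrdConnected :=
    ((hU.convex _).isPreconnected.image _ (S.sim e).continuous_map.continuousOn).ordConnected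
  exact lt_or_gt_of_disjoint_ordConnected (hc e) (hc f) (hU.disjoint e f hs hef)

theorem le_of_mem_closure_of_lt {A B : Set ℝ} (h : ∀ x ∈ A, ∀ y ∈ B, x < y) {x y : ℝ}
    (hx : x ∈ closure A) (hy : y ∈ closure B) : x ≤ y := by
  have h1 : closure B ⊆ {z | ∀ x ∈ A, x ≤ z} :=
    closure_minimal (fun z hz x hx => (h x hx z hz).le)
      (by simp only [Set.ofPred_forall]
          exact isClosed_biInter fun x _ => isClosed_Ici)
  exact closure_minimal (fun x hx => h1 hy x hx) isClosed_Iic hx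

theorem IsAttractor.image_subset_closure [Finite V] [Finite E] (hF : S.IsAttractor F)
    (hU : S.IsConvexOpenWitness U) (e : E) :
    (S.sim e).map '' F (G.tgt e) ⊆ closure ((S.sim e).map '' U (G.tgt e)) :=
  (Set.image_mono (hF.subset_closure hU _)).trans
    (image_closure_subset_closure_image (S.sim e).continuous_map)

theorem lt_of_isOpen_of_le {A : Set ℝ} (hA : IsOpen A) {x : ℝ} (h : ∀ y ∈ A, y ≤ x) :
    ∀ y ∈ A, y < x := fun y hy => by
  have : A ⊆ interior (Set.Iic x) := interior_maximal h hA
  rw [interior_Iic] at this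
  exact this hy

theorem gt_of_isOpen_of_ge {A : Set ℝ} (hA : IsOpen A) {x : ℝ} (h : ∀ y ∈ A, x ≤ y) :
    ∀ y ∈ A, x < y := fun y hy => by
  have : A ⊆ interior (Set.Ici x) := interior_maximal h hA
  rw [interior_Ici] at this
  exact this hy

theorem exists_two_edges [Finite E] (hdeg : ∀ w : V, 2 ≤ G.outDegree w) (w : V) :
    ∃ e f, G.src e = w ∧ G.src f = w ∧ e ≠ f := by
  have := hdeg w
  unfold DirectedMultigraph.outDegree at this
  have : Nontrivial {e : E // G.src e = w} := Finite.one_lt_card_iff_nontrivial.1 this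
  obtain ⟨e, f, h⟩ := exists_pair_ne {e : E // G.src e = w}
  exact ⟨e, f, e.2, f.2, fun h' => h (Subtype.ext h')⟩

/-- No attractor is a single point: such a point at `w` would lie in `U w` but, for some edge `e`
leaving `w`, not in the image of `U (ω(e))`. -/
theorem IsAttractor.nontrivial [Finite V] [Finite E] (hF : S.IsAttractor F)
    (hU : S.IsConvexOpenWitness U) (hdeg : ∀ w : V, 2 ≤ G.outDegree w) (w : V) :
    (F w).Nontrivial := by
  have key (w : V) (hw : (F w).Subsingleton) : (∀ x ∈ F w, x ∈ U w) ∧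
      ∃ e, G.src e = w ∧ ∀ x ∈ F w, x ∉ (S.sim e).map '' U (G.tgt e) := by
    have main (e f : E) (he : G.src e = w) (hf : G.src f = w)
        (h : ∀ x ∈ (S.sim e).map '' U (G.tgt e), ∀ y ∈ (S.sim f).map '' U (G.tgt f), x < y) :
        (∀ x ∈ F w, x ∈ U w) ∧
          ∃ e, G.src e = w ∧ ∀ x ∈ F w, x ∉ (S.sim e).map '' U (G.tgt e) := by
      have hm (e : E) (he : G.src e = w) (x : ℝ) (hx : x ∈ F w) :
          x ∈ closure ((S.sim e).map '' U (G.tgt e)) := by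
        obtain ⟨y, hy⟩ := hF.1 (G.tgt e)
        rw [hw hx (he ▸ hF.map_mem e hy)]
        exact hF.image_subset_closure hU e ⟨y, hy, rfl⟩
      -- A one-point `F w` lies in the closure of both images, hence separates them; openness makes
      -- the separation strict, and convexity then puts the point in `U w`.
      have h1 (x) (hx : x ∈ F w) : ∀ y ∈ (S.sim e).map '' U (G.tgt e), y < x :=
        lt_of_isOpen_of_le ((S.sim e).isOpen_image (hU.isOpen _)) fun y hy =>
          le_of_mem_closure_of_lt h (_root_.subset_closure hy) (hm f hf x hx)
      have h2 (x) (hx : x ∈ F w) : ∀ y ∈ (S.sim f).map '' U (G.tgt f), x < y :=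
        gt_of_isOpen_of_ge ((S.sim f).isOpen_image (hU.isOpen _)) fun y hy =>
          le_of_mem_closure_of_lt h (hm e he x hx) (_root_.subset_closure hy)
      refine ⟨fun x hx => ?_, e, he, fun x hx hxe => (h1 x hx x hxe).false⟩
      obtain ⟨y, hy⟩ := (hU.nonempty (G.tgt e)).image (S.sim e).map
      obtain ⟨z, hz⟩ := (hU.nonempty (G.tgt f)).image (S.sim f).map
      exact (hU.convex w).ordConnected.out (he ▸ hU.image_subset e hy)
        (hf ▸ hU.image_subset f hz) ⟨(h1 x hx y hy).le, (h2 x hx z hz).le⟩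
    obtain ⟨e, f, he, hf, hef⟩ := exists_two_edges hdeg w
    rcases hU.lt_or_gt (he.trans hf.symm) hef with h | h
    · exact main e f he hf h
    · exact main f e hf he fun x hx y hy => h y hy x hx
  by_contra hw
  rw [Set.not_nontrivial_iff] at hw
  obtain ⟨-, e, rfl, he⟩ := key w hw
  have hsub : (F (G.tgt e)).Subsingleton := fun x hx y hy =>
    (S.sim e).map_injective (hw (hF.map_mem e hx) (hF.map_mem e hy))
  obtain ⟨x, hx⟩ := hF.1 (G.tgt e)
  exact he _ (hF.map_mem e hx) ⟨x, (key _ hsub).1 x hx, rfl⟩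

/-- Basic gaps are measured between convex hulls; equality of extreme points turns them into
distances between the pieces of the attractor itself. -/
theorem edgeInterval_bounds (e : E) {m M : ℝ}
    (hm : IsLeast ((S.sim e).map '' F (G.tgt e)) m)
    (hM : IsGreatest ((S.sim e).map '' F (G.tgt e)) M) :
    IsLeast (S.edgeInterval F e) m ∧ IsGreatest (S.edgeInterval F e) M := by
  have h1 : (S.sim e).map '' F (G.tgt e) ⊆ S.edgeInterval F e :=
    Set.image_mono (subset_convexHull ℝ _)
  have h2 : S.edgeInterval F e ⊆ Set.Icc m M := by
    rw [edgeInterval, Set.image_subset_iff]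
    refine convexHull_min (fun x hx => ⟨hm.2 ⟨x, hx, rfl⟩, hM.2 ⟨x, hx, rfl⟩⟩) ?_
    intro x hx y hy a b ha hb hab
    have : (S.sim e).map (a • x + b • y) = a • (S.sim e).map x + b • (S.sim e).map y := by
      simp only [ContractingSimilarity.map, smul_eq_mul]
      linear_combination (-(S.sim e).shift) * hab
    rw [Set.mem_preimage, this]
    exact convex_Icc m M hx hy ha hb hab
  exact ⟨⟨h1 hm.1, fun x hx => (h2 hx).1⟩, ⟨h1 hM.1, fun x hx => (h2 hx).2⟩⟩

theorem IsAttractor.isLeast_image (hF : S.IsAttractor F) (e : E) :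
    IsLeast ((S.sim e).map '' F (G.tgt e)) (sInf (S.edgeInterval F e)) := by
  have hc := (hF.2.1 (G.tgt e)).image (S.sim e).continuous_map
  have hne := (hF.1 (G.tgt e)).image (S.sim e).map
  have h := edgeInterval_bounds e (hc.isLeast_sInf hne) (hc.isGreatest_sSup hne)
  rw [h.1.csInf_eq]
  exact hc.isLeast_sInf hne

theorem IsAttractor.isGreatest_image (hF : S.IsAttractor F) (e : E) :
    IsGreatest ((S.sim e).map '' F (G.tgt e)) (sSup (S.edgeInterval F e)) := by
  have hc := (hF.2.1 (G.tgt e)).image (S.sim e).continuous_map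
  have hne := (hF.1 (G.tgt e)).image (S.sim e).map
  have h := edgeInterval_bounds e (hc.isLeast_sInf hne) (hc.isGreatest_sSup hne)
  rw [h.2.csSup_eq]
  exact hc.isGreatest_sSup hne

theorem IsAttractor.sInf_lt_sSup [Finite V] [Finite E] (hF : S.IsAttractor F)
    (hU : S.IsConvexOpenWitness U) (hdeg : ∀ w : V, 2 ≤ G.outDegree w) (e : E) :
    sInf (S.edgeInterval F e) < sSup (S.edgeInterval F e) := by
  obtain ⟨x, hx, y, hy, hxy⟩ := ((hF.nontrivial hU hdeg (G.tgt e)).image (S.sim e).map_injective)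
  have h1 := (hF.isLeast_image e).2
  have h2 := (hF.isGreatest_image e).2
  rcases hxy.lt_or_gt with h | h
  · exact (h1 hx).trans_lt (h.trans_le (h2 hy))
  · exact (h1 hy).trans_lt (h.trans_le (h2 hx))

/-- The ranking only sorts left endpoints. The COSC leaves two possible orders of two pieces, and
the wrong one contradicts the sorting because pieces have positive length. -/
theorem IsAttractor.rankedEdge_ordered [Finite V] [Finite E] (hF : S.IsAttractor F)
    (hU : S.IsConvexOpenWitness U) (hdeg : ∀ w : V, 2 ≤ G.outDegree w) (w : V)
    (i j : Fin (G.outDegree w)) (hij : i < j) :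
    sSup (S.edgeInterval F (S.rankedEdge F w i)) ≤
      sInf (S.edgeInterval F (S.rankedEdge F w j)) := by
  set e := S.rankedEdge F w i with he
  set f := S.rankedEdge F w j with hf
  have hef : (e : E) ≠ f := fun h =>
    hij.ne ((S.rankedEdge F w).injective (Subtype.ext h))
  have hcl (e f : E) (h : ∀ x ∈ (S.sim e).map '' U (G.tgt e),
      ∀ y ∈ (S.sim f).map '' U (G.tgt f), x < y) :
      sSup (S.edgeInterval F e) ≤ sInf (S.edgeInterval F f) :=
    le_of_mem_closure_of_lt h (hF.image_subset_closure hU e (hF.isGreatest_image e).1)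
      (hF.image_subset_closure hU f (hF.isLeast_image f).1)
  rcases hU.lt_or_gt (e.2.trans f.2.symm) hef with h | h
  · exact hcl e f h
  · have h1 := hcl f e fun x hx y hy => h y hy x hx
    have h2 := hF.sInf_lt_sSup hU hdeg f
    have h3 : sInf (S.edgeInterval F e) ≤ sInf (S.edgeInterval F f) :=
      S.rankedEdge_monotone F w hij.le
    linarith

theorem IsAttractor.eq_iUnion_rankedEdge [Finite E] (hF : S.IsAttractor F) (w : V) :
    F w = ⋃ i : Fin (G.outDegree w), (S.sim (S.rankedEdge F w i)).map ''
      F (G.tgt (S.rankedEdge F w i)) := by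
  ext x
  rw [Set.mem_iUnion]
  constructor
  · intro hx
    obtain ⟨e, he, y, hy, rfl⟩ := hF.exists_map_eq hx
    obtain ⟨i, hi⟩ := (S.rankedEdge F w).surjective ⟨e, he⟩
    exact ⟨i, by rw [hi]; exact ⟨y, hy, rfl⟩⟩
  · rintro ⟨i, y, hy, rfl⟩
    have := hF.map_mem _ hy
    rwa [(S.rankedEdge F w i).2] at this

/-! ### Gap lengths of graph-directed attractors, one edge at a time. -/

variable [Finite V] [Finite E]

theorem IsAttractor.mul_mem_gapLengths (hF : S.IsAttractor F)
    (hU : S.IsConvexOpenWitness U) (hdeg : ∀ w : V, 2 ≤ G.outDegree w) (e : E) {t : ℝ}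
    (ht : t ∈ gapLengths (F (G.tgt e))) :
    |(S.sim e).ratio| * t ∈ gapLengths (F (G.src e)) := by
  obtain ⟨i, hi⟩ := (S.rankedEdge F (G.src e)).surjective ⟨e, rfl⟩
  obtain ⟨a, b, h, hab⟩ := mul_mem_gapLengths_image (S.sim e) ht
  refine ⟨a, b, ?_, hab⟩
  rw [hF.eq_iUnion_rankedEdge (G.src e)]
  refine isGap_iUnion_of_isGap (i := i) (fun i => hF.isLeast_image _)
    (fun i => hF.isGreatest_image _) (hF.rankedEdge_ordered hU hdeg _) ?_
  rw [hi]
  exact h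

theorem IsAttractor.basicGap_mem_gapLengths (hF : S.IsAttractor F)
    (hU : S.IsConvexOpenWitness U) (hdeg : ∀ w : V, 2 ≤ G.outDegree w) {w : V}
    {k : Fin (G.outDegree w - 1)} (hk : 0 < S.basicGap F w k) :
    S.basicGap F w k ∈ gapLengths (F w) := by
  refine ⟨_, _, ?_, rfl⟩
  rw [hF.eq_iUnion_rankedEdge w]
  exact isGap_iUnion_of_lt (i := ⟨k, by omega⟩) (j := ⟨k + 1, by omega⟩)
    (fun i => hF.isLeast_image (S.rankedEdge F w i))
    (fun i => hF.isGreatest_image (S.rankedEdge F w i)) (hF.rankedEdge_ordered hU hdeg _) rfl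
    (sub_pos.1 hk)

theorem IsAttractor.basicGap_or_of_mem_gapLengths (hF : S.IsAttractor F)
    (hU : S.IsConvexOpenWitness U) (hdeg : ∀ w : V, 2 ≤ G.outDegree w) {w : V} {t : ℝ}
    (ht : t ∈ gapLengths (F w)) :
    (∃ k, t = S.basicGap F w k) ∨
      ∃ e, G.src e = w ∧ ∃ s ∈ gapLengths (F (G.tgt e)), t = |(S.sim e).ratio| * s := by
  obtain ⟨a, b, h, hab⟩ := ht
  rw [hF.eq_iUnion_rankedEdge w] at h
  rcases IsGap.of_iUnion (fun i => hF.isLeast_image (S.rankedEdge F w i))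
    (fun i => hF.isGreatest_image (S.rankedEdge F w i)) (hF.rankedEdge_ordered hU hdeg _)
    (fun i => hF.sInf_lt_sSup hU hdeg _) h with ⟨i, hi⟩ | ⟨⟨i, hi⟩, ⟨j, hj⟩, hij, rfl, rfl⟩
  · exact Or.inr ⟨_, (S.rankedEdge F w i).2, exists_of_mem_gapLengths_image _ ⟨a, b, hi, hab⟩⟩
  · obtain rfl : j = i + 1 := hij
    exact Or.inl ⟨⟨i, by omega⟩, hab⟩

end GraphDirectedIFS

/-! ### Paths, their weights, and gaps as images of basic gaps. -/

namespace DirectedMultigraph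

variable {V E : Type*} {G : DirectedMultigraph V E}

theorem Traverses.append {p q : List E} {a b c : V} (hp : G.Traverses a p b)
    (hq : G.Traverses b q c) : G.Traverses a (p ++ q) c := by
  induction p generalizing a with
  | nil => cases hp; exact hq
  | cons e p ih => exact ⟨hp.1, ih hp.2⟩

/-- A list of consecutive edges can be cut at any vertex that it goes through. -/
theorem Traverses.exists_split {L : List E} {a b v : V} (hL : G.Traverses a L b)
    (hv : G.GoesThrough L v) : ∃ p q, L = p ++ q ∧ G.Traverses a p v ∧ G.Traverses v q b := by
  induction L generalizing a with
  | nil => obtain ⟨e, he, -⟩ := hv; simp at he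
  | cons e L ih =>
    obtain ⟨f, hf, hfv⟩ := hv
    by_cases h : G.GoesThrough L v
    · obtain ⟨p, q, rfl, hp, hq⟩ := ih hL.2 h
      exact ⟨e :: p, q, rfl, ⟨hL.1, hp⟩, hq⟩
    · rcases List.mem_cons.1 hf with rfl | hf
      · rcases hfv with rfl | rfl
        · exact ⟨[], f :: L, rfl, hL.1.symm, rfl, hL.2⟩
        · exact ⟨[f], L, rfl, ⟨hL.1, rfl⟩, hL.2⟩
      · exact absurd ⟨f, hf, hfv⟩ h

end DirectedMultigraph

namespace GraphDirectedIFS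

section Weight

variable {V E : Type*} {G : DirectedMultigraph V E} (S : GraphDirectedIFS G)

/-- The product of the absolute contraction ratios along a list of edges. -/
def weight (p : List E) : ℝ := (p.map fun e => |(S.sim e).ratio|).prod

theorem weight_nil : S.weight [] = 1 := rfl

theorem weight_cons (e : E) (p : List E) :
    S.weight (e :: p) = |(S.sim e).ratio| * S.weight p := by simp [weight]

theorem weight_append (p q : List E) : S.weight (p ++ q) = S.weight p * S.weight q := by
  simp [weight]

theorem weight_pos (p : List E) : 0 < S.weight p := by
  induction p with
  | nil => exact one_pos
  | cons e p ih => rw [weight_cons]; exact mul_pos (S.sim e).abs_ratio_pos ih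

theorem weight_le_one (p : List E) : S.weight p ≤ 1 := by
  induction p with
  | nil => exact le_rfl
  | cons e p ih =>
    rw [weight_cons]
    exact mul_le_one₀ (S.sim e).abs_ratio_lt_one.le (S.weight_pos p).le ih

theorem weight_lt_one {p : List E} (hp : p ≠ []) : S.weight p < 1 := by
  cases p with
  | nil => exact absurd rfl hp
  | cons e p =>
    rw [weight_cons]
    exact mul_lt_one_of_nonneg_of_lt_one_left (abs_nonneg _) (S.sim e).abs_ratio_lt_one
      (S.weight_le_one p)

end Weight

variable {V E : Type*} [Finite V] [Finite E] {G : DirectedMultigraph V E} {S : GraphDirectedIFS G}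
  {U F : V → Set ℝ}

theorem IsAttractor.weight_mul_mem_gapLengths (hF : S.IsAttractor F)
    (hU : S.IsConvexOpenWitness U) (hdeg : ∀ w : V, 2 ≤ G.outDegree w) {w z : V} {p : List E}
    (hp : G.Traverses w p z) {t : ℝ} (ht : t ∈ gapLengths (F z)) :
    S.weight p * t ∈ gapLengths (F w) := by
  induction p generalizing w with
  | nil => cases hp; simpa [weight_nil] using ht
  | cons e p ih =>
    obtain ⟨rfl, hp⟩ := hp
    rw [weight_cons, mul_assoc]
    exact hF.mul_mem_gapLengths hU hdeg e (ih hp)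

/-- Every gap is the image of a basic gap along a path. -/
theorem IsAttractor.exists_path_of_mem_gapLengths (hF : S.IsAttractor F)
    (hU : S.IsConvexOpenWitness U) (hdeg : ∀ w : V, 2 ≤ G.outDegree w) {w : V} {t : ℝ}
    (ht : t ∈ gapLengths (F w)) :
    ∃ (p : List E) (x : Σ z : V, Fin (G.outDegree z - 1)),
      G.Traverses w p x.1 ∧ 0 < S.basicGap F x.1 x.2 ∧
        t = S.weight p * S.basicGap F x.1 x.2 := by
  obtain ⟨c, hc0, hc1, hc⟩ := S.exists_ratio_bound
  have hmax (w : V) : ∃ M, ∀ t ∈ gapLengths (F w), t ≤ M := by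
    obtain ⟨M, hM⟩ := (hF.2.1 w).bddAbove
    obtain ⟨m, hm⟩ := (hF.2.1 w).bddBelow
    refine ⟨M - m, ?_⟩
    rintro _ ⟨a, b, h, rfl⟩
    exact sub_le_sub (hM h.2.1) (hm h.1)
  choose M hM using hmax
  obtain ⟨D, hD⟩ := (Set.finite_range M).bddAbove
  -- No gap is longer than `D`, and undoing an edge lengthens a gap by a factor at least `1 / c`, so
  -- a gap longer than `c ^ n * D` becomes basic after finitely many backward steps.
  have step (n : ℕ) : ∀ w, ∀ t ∈ gapLengths (F w), c ^ n * D < t →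
      ∃ (p : List E) (x : Σ z : V, Fin (G.outDegree z - 1)),
        G.Traverses w p x.1 ∧ 0 < S.basicGap F x.1 x.2 ∧
          t = S.weight p * S.basicGap F x.1 x.2 := by
    induction n with
    | zero =>
      intro w t ht h
      have := (hM w t ht).trans (hD ⟨w, rfl⟩)
      simp only [pow_zero, one_mul] at h
      linarith
    | succ n ih =>
      intro w t ht h
      have ht0 := gapLengths_pos ht
      rcases hF.basicGap_or_of_mem_gapLengths hU hdeg ht with ⟨k, rfl⟩ | ⟨e, rfl, s, hs, rfl⟩
      · exact ⟨[], ⟨w, k⟩, rfl, ht0, by simp [weight_nil]⟩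
      · have hs0 := gapLengths_pos hs
        have h1 : c ^ n * D < s := by
          have h2 : |(S.sim e).ratio| * s ≤ c * s := mul_le_mul_of_nonneg_right (hc e) hs0.le
          refine lt_of_mul_lt_mul_left (a := c) ?_ hc0.le
          calc c * (c ^ n * D) = c ^ (n + 1) * D := by ring
            _ < _ := h
            _ ≤ _ := h2
        obtain ⟨p, x, hp, hx, rfl⟩ := ih _ s hs h1
        exact ⟨e :: p, x, ⟨rfl, hp⟩, hx, by rw [weight_cons, mul_assoc]⟩
  have hlim : Filter.Tendsto (fun n : ℕ => c ^ n * D) Filter.atTop (nhds (0 * D)) :=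
    (tendsto_pow_atTop_nhds_zero_of_lt_one hc0.le hc1).mul_const D
  rw [zero_mul] at hlim
  obtain ⟨n, hn⟩ := (hlim.eventually_lt_const (gapLengths_pos ht)).exists
  exact step n w t ht hn

end GraphDirectedIFS

/-! ### Multiplicative algebra of rational powers. -/

section RatPowers

variable {A B : Finset ℝ}

theorem mem_ratPowers_iff {x : ℝ} :
    x ∈ ratPowers A ↔ ∃ q : ℝ → ℚ, x = ∏ a ∈ A, a ^ (q a : ℝ) := by
  constructor
  · rintro (rfl | ⟨q, -, rfl⟩)
    · exact ⟨0, by simp⟩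
    · exact ⟨q, rfl⟩
  · rintro ⟨q, rfl⟩
    by_cases h : ∃ a ∈ A, q a ≠ 0
    · exact Or.inr ⟨q, h, rfl⟩
    · push Not at h
      exact Or.inl (Finset.prod_eq_one fun a ha => by simp [h a ha])

theorem ratPowers_mul (hA : ∀ a ∈ A, 0 < a) {x y : ℝ} (hx : x ∈ ratPowers A)
    (hy : y ∈ ratPowers A) : x * y ∈ ratPowers A := by
  rw [mem_ratPowers_iff] at *
  obtain ⟨q, rfl⟩ := hx
  obtain ⟨r, rfl⟩ := hy
  refine ⟨q + r, ?_⟩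
  rw [← Finset.prod_mul_distrib]
  exact Finset.prod_congr rfl fun a ha => by simp [Real.rpow_add (hA a ha)]

theorem ratPowers_rpow (hA : ∀ a ∈ A, 0 < a) {x : ℝ} (hx : x ∈ ratPowers A) (r : ℚ) :
    x ^ (r : ℝ) ∈ ratPowers A := by
  rw [mem_ratPowers_iff] at *
  obtain ⟨q, rfl⟩ := hx
  refine ⟨fun a => q a * r, ?_⟩
  rw [← Real.finsetProd_rpow _ _ fun a ha => (Real.rpow_pos_of_pos (hA a ha) _).le]
  exact Finset.prod_congr rfl fun a ha => by
    rw [← Real.rpow_mul (hA a ha).le]; push_cast; rfl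

theorem ratPowers_inv (hA : ∀ a ∈ A, 0 < a) {x : ℝ} (hx : x ∈ ratPowers A) :
    x⁻¹ ∈ ratPowers A := by
  have := ratPowers_rpow hA hx (-1)
  rwa [Rat.cast_neg, Rat.cast_one, Real.rpow_neg_one] at this

theorem ratPowers_pow (hA : ∀ a ∈ A, 0 < a) {x : ℝ} (hx : x ∈ ratPowers A) (n : ℕ) :
    x ^ n ∈ ratPowers A := by
  have := ratPowers_rpow hA hx n
  rwa [Rat.cast_natCast, Real.rpow_natCast] at this

/-- Closure under roots is what rational, rather than integer, exponents provide. -/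
theorem ratPowers_of_pow (hA : ∀ a ∈ A, 0 < a) {x : ℝ} (hx0 : 0 ≤ x) {n : ℕ} (hn : n ≠ 0)
    (hx : x ^ n ∈ ratPowers A) : x ∈ ratPowers A := by
  have := ratPowers_rpow hA hx (n : ℚ)⁻¹
  rwa [Rat.cast_inv, Rat.cast_natCast, Real.pow_rpow_inv_natCast hx0 hn] at this

theorem prod_rpow_ite {a : ℝ} (ha : a ∈ A) :
    a = ∏ b ∈ A, b ^ ((if b = a then 1 else 0 : ℚ) : ℝ) := by
  rw [Finset.prod_eq_single a (fun b _ h => by simp [h]) fun h => absurd ha h]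
  simp

theorem mem_ratPowers {a : ℝ} (ha : a ∈ A) : a ∈ ratPowers A :=
  mem_ratPowers_iff.2 ⟨_, prod_rpow_ite ha⟩

theorem mem_nonnegRatPowersStar {a : ℝ} (ha : a ∈ A) : a ∈ nonnegRatPowersStar A :=
  ⟨fun b => if b = a then 1 else 0, fun b _ => by dsimp only; split_ifs <;> norm_num,
    ⟨a, ha, by simp⟩, prod_rpow_ite ha⟩

theorem nonnegRatPowersStar_mul (hA : ∀ a ∈ A, 0 < a) {x y : ℝ}
    (hx : x ∈ nonnegRatPowersStar A) (hy : y ∈ nonnegRatPowersStar A) :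
    x * y ∈ nonnegRatPowersStar A := by
  obtain ⟨q, hq, ⟨a, ha, hqa⟩, rfl⟩ := hx
  obtain ⟨r, hr, -, rfl⟩ := hy
  refine ⟨q + r, fun a ha => add_nonneg (hq a ha) (hr a ha), ⟨a, ha, ?_⟩, ?_⟩
  · exact (add_pos_of_pos_of_nonneg ((hq a ha).lt_of_ne hqa.symm) (hr a ha)).ne'
  · rw [← Finset.prod_mul_distrib]
    exact Finset.prod_congr rfl fun a ha => by simp [Real.rpow_add (hA a ha)]

theorem lt_one_of_mem_nonnegRatPowersStar (hA : ∀ a ∈ A, 0 < a ∧ a < 1) {x : ℝ}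
    (hx : x ∈ nonnegRatPowersStar A) : x < 1 := by
  obtain ⟨q, hq, ⟨a, ha, hqa⟩, rfl⟩ := hx
  have hq' : 0 < (q a : ℝ) := Rat.cast_pos.2 ((hq a ha).lt_of_ne hqa.symm)
  have h := Finset.prod_lt_prod (s := A) (f := fun a => a ^ (q a : ℝ)) (g := fun _ => (1 : ℝ))
    (fun b hb => Real.rpow_pos_of_pos (hA b hb).1 _)
    (fun b hb => Real.rpow_le_one (hA b hb).1.le (hA b hb).2.le (Rat.cast_nonneg.2 (hq b hb)))
    ⟨a, ha, Real.rpow_lt_one (hA a ha).1.le (hA a ha).2 hq'⟩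
  simpa using h

/-- Products of an element of `A^ℚ` and an element of `B^{ℚ₊*}`. -/
def mixedPowers (A B : Finset ℝ) : Set ℝ :=
  {s | ∃ x ∈ ratPowers A, ∃ y ∈ nonnegRatPowersStar B, s = x * y}

theorem mixedPowers_mul (hA : ∀ a ∈ A, 0 < a) (hB : ∀ b ∈ B, 0 < b) {s t : ℝ}
    (hs : s ∈ mixedPowers A B) (ht : t ∈ mixedPowers A B) : s * t ∈ mixedPowers A B := by
  obtain ⟨x, hx, y, hy, rfl⟩ := hs
  obtain ⟨x', hx', y', hy', rfl⟩ := ht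
  exact ⟨_, ratPowers_mul hA hx hx', _, nonnegRatPowersStar_mul hB hy hy', by ring⟩

theorem ratPowers_mul_mixedPowers (hA : ∀ a ∈ A, 0 < a) {s t : ℝ}
    (hs : s ∈ ratPowers A) (ht : t ∈ mixedPowers A B) : s * t ∈ mixedPowers A B := by
  obtain ⟨x, hx, y, hy, rfl⟩ := ht
  exact ⟨_, ratPowers_mul hA hs hx, y, hy, by ring⟩

theorem prod_pow_eq_one_or_mem_mixedPowers {ι : Type*} (hA : ∀ a ∈ A, 0 < a)
    (hB : ∀ b ∈ B, 0 < b) {r : ι → ℝ} (hr : ∀ i, r i ∈ mixedPowers A B) (n : ι → ℕ)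
    (s : Finset ι) : ∏ i ∈ s, r i ^ n i = 1 ∨ ∏ i ∈ s, r i ^ n i ∈ mixedPowers A B := by
  have hmul {x y : ℝ} (hx : x = 1 ∨ x ∈ mixedPowers A B) (hy : y = 1 ∨ y ∈ mixedPowers A B) :
      x * y = 1 ∨ x * y ∈ mixedPowers A B := by
    rcases hx with rfl | hx
    · simpa using hy
    rcases hy with rfl | hy
    · simpa using Or.inr hx
    exact Or.inr (mixedPowers_mul hA hB hx hy)
  refine Finset.prod_induction _ (fun x => x = 1 ∨ x ∈ mixedPowers A B) (fun x y => hmul)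
    (Or.inl rfl) fun i _ => ?_
  induction n i with
  | zero => exact Or.inl (pow_zero _)
  | succ k ih => rw [pow_succ]; exact hmul ih (Or.inr (hr i))

/-- If `x * y` and `x` are in A^ℚ, so is `y`; since `y < 1`, it is not the trivial element, so it
lies in A^{ℚ*}, against `h`. -/
theorem disjoint_ratPowers_mixedPowers (hA : ∀ a ∈ A, 0 < a) (hB : ∀ b ∈ B, 0 < b ∧ b < 1)
    (h : ratPowersStar A ∩ nonnegRatPowersStar B = ∅) :
    Disjoint (ratPowers A) (mixedPowers A B) := by
  rw [Set.disjoint_left]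
  rintro _ hs ⟨x, hx, y, hy, rfl⟩
  have hx0 : x ≠ 0 := by
    obtain ⟨q, rfl⟩ := mem_ratPowers_iff.1 hx
    exact (Finset.prod_pos fun a ha => Real.rpow_pos_of_pos (hA a ha) _).ne'
  have hyA : y ∈ ratPowers A := by
    have := ratPowers_mul hA (ratPowers_inv hA hx) hs
    rwa [inv_mul_cancel_left₀ hx0] at this
  rcases hyA with rfl | hyA
  · exact (lt_one_of_mem_nonnegRatPowersStar hB hy).false
  · exact Set.notMem_empty y (h ▸ ⟨hyA, hy⟩)

end RatPowers

namespace GraphDirectedIFS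

variable {V E : Type*} [Finite E] {G : DirectedMultigraph V E} (S : GraphDirectedIFS G)

theorem mem_absRatios {s : Set E} {x : ℝ} :
    x ∈ S.absRatios s ↔ ∃ e ∈ s, |(S.sim e).ratio| = x := by
  simp [absRatios]

theorem absRatios_pos_lt_one (s : Set E) : ∀ x ∈ S.absRatios s, 0 < x ∧ x < 1 := by
  intro x hx
  obtain ⟨e, -, rfl⟩ := S.mem_absRatios.1 hx
  exact ⟨(S.sim e).abs_ratio_pos, (S.sim e).abs_ratio_lt_one⟩

theorem weight_mem_ratPowers {s : Set E} {p : List E} (hp : ∀ e ∈ p, e ∈ s) :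
    S.weight p ∈ ratPowers (S.absRatios s) := by
  induction p with
  | nil => exact Or.inl rfl
  | cons e p ih =>
    rw [weight_cons]
    exact ratPowers_mul (fun a ha => (S.absRatios_pos_lt_one s a ha).1)
      (mem_ratPowers (S.mem_absRatios.2 ⟨e, hp e (by simp), rfl⟩))
      (ih fun f hf => hp f (List.mem_cons_of_mem _ hf))

theorem weight_mem_mixedPowers {s t : Set E} {p : List E} (hp : ∀ e ∈ p, e ∈ s ∨ e ∈ t)
    (h : ∃ e ∈ p, e ∈ t) : S.weight p ∈ mixedPowers (S.absRatios s) (S.absRatios t) := by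
  have hs := fun a ha => (S.absRatios_pos_lt_one s a ha).1
  have ht := fun a ha => (S.absRatios_pos_lt_one t a ha).1
  have hmem {e : E} (he : e ∈ t) :
      |(S.sim e).ratio| ∈ nonnegRatPowersStar (S.absRatios t) :=
    mem_nonnegRatPowersStar (S.mem_absRatios.2 ⟨e, he, rfl⟩)
  induction p with
  | nil => simp at h
  | cons e p ih =>
    rw [weight_cons]
    have hp' : ∀ f ∈ p, f ∈ s ∨ f ∈ t := fun f hf => hp f (List.mem_cons_of_mem _ hf)
    by_cases hpt : ∃ f ∈ p, f ∈ t
    · rcases hp e (by simp) with he | he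
      · exact ratPowers_mul_mixedPowers hs
          (mem_ratPowers (S.mem_absRatios.2 ⟨e, he, rfl⟩)) (ih hp' hpt)
      · exact mixedPowers_mul hs ht ⟨1, Or.inl rfl, _, hmem he, (one_mul _).symm⟩ (ih hp' hpt)
    -- Here the head `e` is the only edge of the list in `t`: it supplies the factor from `t`, and
    -- the tail supplies the factor from `s`.
    · push Not at hpt
      have he : e ∈ t := by
        obtain ⟨f, hf, hft⟩ := h
        rcases List.mem_cons.1 hf with rfl | hf
        · exact hft
        · exact absurd hft (hpt f hf)
      exact ⟨_, S.weight_mem_ratPowers fun f hf => (hp' f hf).resolve_right (hpt f hf), _,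
        hmem he, mul_comm _ _⟩

end GraphDirectedIFS

/-! ### Standard systems as graph-directed systems with one vertex. -/

namespace StandardIFS

/-- The graph with one vertex and one loop for each similarity of a standard IFS. -/
def graph (I : StandardIFS) : DirectedMultigraph Unit I := ⟨fun _ => (), fun _ => ()⟩

/-- A standard IFS as a graph-directed IFS with one vertex. -/
def toGraphDirected (I : StandardIFS) : GraphDirectedIFS I.graph := ⟨fun T => T⟩

variable {I : StandardIFS} {K : Set ℝ}

theorem IsAttractor.toGraphDirected (h : I.IsAttractor K) :
    I.toGraphDirected.IsAttractor fun _ => K := by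
  refine ⟨fun _ => h.1, fun _ => h.2.1, fun _ => h.2.2.trans ?_⟩
  ext x
  simp [graph, StandardIFS.toGraphDirected]

theorem COSC.exists_witness (h : I.COSC) : ∃ U, I.toGraphDirected.IsConvexOpenWitness U := by
  obtain ⟨U, h1, h2, h3, h4, h5⟩ := h
  exact ⟨fun _ => U, fun _ => h1, fun _ => h2, fun _ => h3, fun e => h4 e e.2,
    fun e f _ hef => h5 e e.2 f f.2 fun h => hef (Subtype.ext h)⟩

/-- A standard IFS whose attractor is not a point has at least two similarities. -/
theorem IsAttractor.two_le_outDegree (h : I.IsAttractor K) (hK : K.Nontrivial) (w : Unit) :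
    2 ≤ I.graph.outDegree w := by
  have hcard : I.graph.outDegree w = I.card := by
    rw [DirectedMultigraph.outDegree, ← Nat.card_eq_finsetCard I]
    exact Nat.card_congr (Equiv.subtypeUnivEquiv fun _ => rfl)
  rw [hcard]
  by_contra! hlt
  have hle := Finset.card_le_one.1 (Nat.le_of_lt_succ hlt)
  have hmem {x : ℝ} (hx : x ∈ K) : ∃ T ∈ I, ∃ y ∈ K, T.map y = x := by
    rw [h.2.2] at hx
    obtain ⟨T, hT, y, hy, hxy⟩ := Set.mem_iUnion₂.1 hx
    exact ⟨T, hT, y, hy, hxy⟩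
  have hl := h.2.1.isLeast_sInf h.1
  have hg := h.2.1.isGreatest_sSup h.1
  obtain ⟨a, ha, b, hb, hab⟩ := hK.exists_lt
  have hlt : sInf K < sSup K := (hl.2 ha).trans_lt (hab.trans_le (hg.2 hb))
  -- Both extreme points of `K` come from the same map `T`, so the diameter of `K` would be at most
  -- `|T.ratio|` times itself.
  obtain ⟨T, hT, x, hx, hTx⟩ := hmem hl.1
  obtain ⟨T', hT', y, hy, hTy⟩ := hmem hg.1
  obtain rfl := hle T hT T' hT'
  have h1 := T.dist_map y x
  rw [hTx, hTy, Real.dist_eq, Real.dist_eq, abs_of_pos (sub_pos.2 hlt)] at h1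
  have h2 : |y - x| ≤ sSup K - sInf K :=
    abs_sub_le_iff.2 ⟨sub_le_sub (hg.2 hy) (hl.2 hx), sub_le_sub (hg.2 hx) (hl.2 hy)⟩
  have h3 := mul_le_mul_of_nonneg_left h2 (abs_nonneg T.ratio)
  have h4 := mul_lt_of_lt_one_left (sub_pos.2 hlt) T.abs_ratio_lt_one
  linarith

end StandardIFS

/-! ### Dickson's lemma, and ratios realised by closed paths. -/

/-- Two terms of a sequence in a finite coloring of words with the same color, the earlier word
having no more occurrences of each letter. -/
theorem exists_lt_color_eq_count_le {ι κ : Type*} [Finite ι] [DecidableEq ι] [Finite κ]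
    (p : ℕ → List ι) (c : ℕ → κ) :
    ∃ m n, m < n ∧ c m = c n ∧ ∀ i, (p m).count i ≤ (p n).count i := by
  have h1 : WellQuasiOrdered (· = · : κ → κ → Prop) := Finite.wellQuasiOrdered _
  -- Dickson's lemma for the vectors of letter counts.
  have h2 : WellQuasiOrdered (· ≤ · : (ι → ℕ) → (ι → ℕ) → Prop) := wellQuasiOrdered_le
  obtain ⟨m, n, hmn, h⟩ := (h1.prod h2) fun n => (c n, fun i => (p n).count i)
  exact ⟨m, n, hmn, h.1, h.2⟩

namespace GraphDirectedIFS

/-- The weight depends only on letter counts, so comparing counts is enough to divide weights. -/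
theorem weight_eq_prod {V E : Type*} [Fintype E] [DecidableEq E] {G : DirectedMultigraph V E}
    (S : GraphDirectedIFS G) (p : List E) :
    S.weight p = ∏ e, |(S.sim e).ratio| ^ p.count e := by
  rw [weight, Finset.prod_list_map_count]
  exact Finset.prod_subset (Finset.subset_univ _) fun e _ he => by
    rw [List.count_eq_zero_of_not_mem (by simpa using he), pow_zero]

/-- If one positive basic gap at `u` is incommensurable with all others, then the absolute ratio of
a similarity that preserves the gaps of `F u` is the weight of a closed path at `u`. -/
theorem IsAttractor.exists_loop_weight {V E : Type*} [Finite V] [Finite E]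
    {G : DirectedMultigraph V E} {S : GraphDirectedIFS G} {U F : V → Set ℝ}
    (hF : S.IsAttractor F) (hU : S.IsConvexOpenWitness U)
    (hdeg : ∀ w : V, 2 ≤ G.outDegree w) {u : V} {k : Fin (G.outDegree u - 1)}
    (hk : 0 < S.basicGap F u k)
    (hinc : ∀ x : Σ z : V, Fin (G.outDegree z - 1), ⟨u, k⟩ ≠ x → S.basicGap F x.1 x.2 ≠ 0 →
      S.basicGap F u k / S.basicGap F x.1 x.2 ∉ ratPowers (S.absRatios Set.univ))
    {r : ℝ} (hr0 : 0 < r) (hr1 : r < 1)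
    (hr : ∀ t ∈ gapLengths (F u), r * t ∈ gapLengths (F u)) :
    ∃ p, p ≠ [] ∧ G.Traverses u p u ∧ r = S.weight p := by
  have hpos := fun a ha => (S.absRatios_pos_lt_one Set.univ a ha).1
  have hW (p : List E) : S.weight p ∈ ratPowers (S.absRatios Set.univ) :=
    S.weight_mem_ratPowers fun _ _ => trivial
  have hpow (n : ℕ) : r ^ n * S.basicGap F u k ∈ gapLengths (F u) := by
    induction n with
    | zero => simpa using hF.basicGap_mem_gapLengths hU hdeg hk
    | succ n ih => rw [pow_succ', mul_assoc]; exact hr _ ih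
  choose p x hp hx hpx using fun n => hF.exists_path_of_mem_gapLengths hU hdeg (hpow n)
  -- There are finitely many basic gaps, so two powers of `r` lead to the same one; it cancels, and
  -- a positive power of `r` is a quotient of path weights.
  have hrA : r ∈ ratPowers (S.absRatios Set.univ) := by
    obtain ⟨m, n, hmn, he⟩ : ∃ m n, m < n ∧ x m = x n := by
      obtain ⟨m, n, hmn, he⟩ := Finite.exists_ne_map_eq_of_infinite x
      rcases hmn.lt_or_gt with h | h
      · exact ⟨m, n, h, he⟩
      · exact ⟨n, m, h, he.symm⟩
    obtain ⟨d, rfl⟩ := Nat.exists_eq_add_of_lt hmn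
    refine ratPowers_of_pow hpos hr0.le (Nat.succ_ne_zero d) ?_
    have h1 := hpx m
    have h2 := hpx (m + d + 1)
    rw [← he] at h2
    have h3 : r ^ (d + 1) = S.weight (p (m + d + 1)) * (S.weight (p m))⁻¹ := by
      have hg := hx m
      have hw := S.weight_pos (p m)
      rw [eq_mul_inv_iff_mul_eq₀ hw.ne']
      refine mul_right_cancel₀ hg.ne' ?_
      rw [mul_assoc, ← h1, ← h2]
      ring
    rw [h3]
    exact ratPowers_mul hpos (hW _) (ratPowers_inv hpos (hW _))
  have h1 := hpx 1
  rw [pow_one] at h1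
  -- Now that `r` is in A^ℚ, a different basic gap behind `r` times the original one would be
  -- commensurable with it.
  have hxu : ⟨u, k⟩ = x 1 := by
    by_contra hne
    refine hinc _ hne (hx 1).ne' ?_
    have : S.basicGap F u k / S.basicGap F (x 1).1 (x 1).2 = S.weight (p 1) * r⁻¹ := by
      rw [div_eq_iff (hx 1).ne', mul_right_comm, ← h1]
      field_simp
    rw [this]
    exact ratPowers_mul hpos (hW _) (ratPowers_inv hpos hrA)
  have hp1 := hp 1
  rw [← hxu] at h1 hp1
  have hrw : r = S.weight (p 1) := mul_right_cancel₀ hk.ne' h1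
  exact ⟨p 1, fun h => by simp [hrw, h, weight_nil] at hr1, hp1, hrw⟩

end GraphDirectedIFS

/-! ### The contradiction between loops at `u` and the circuit `L`. -/

theorem lemma4p1 {V E : Type*} [Finite V] [Finite E] (G : DirectedMultigraph V E)
    (hdeg : ∀ w : V, 2 ≤ G.outDegree w)
    (L : List E) (hL : G.IsCircuit L)
    (u v : V) (hu : ¬ G.GoesThrough L u) (hv : G.GoesThrough L v)
    (huv : ∃ p : List E, G.IsDirectedPath u p v)
    (S : GraphDirectedIFS G) (hS : S.COSC)
    (F : V → Set ℝ) (hF : S.IsAttractor F)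
    (hi : ratPowersStar (S.absRatios {e | e ∈ L}) ∩
      nonnegRatPowersStar (S.absRatios {e | e ∉ L}) = ∅)
    (hii : (S.positiveGaps F u).Nonempty ∧ (S.positiveGaps F v).Nonempty)
    (hiii : ∀ (w z : V) (k : Fin (G.outDegree w - 1)) (m : Fin (G.outDegree z - 1)),
      (⟨w, k⟩ : Σ x : V, Fin (G.outDegree x - 1)) ≠ ⟨z, m⟩ → S.basicGap F z m ≠ 0 →
      S.basicGap F w k / S.basicGap F z m ∉
        ratPowers (S.absRatios ({e | e ∈ L} ∪ {e | e ∉ L}))) :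
    ¬ ∃ I : StandardIFS, I.COSC ∧ I.IsAttractor (F u) := by
  rintro ⟨I, hI, hK⟩
  have : DecidableEq I := Classical.decEq I
  obtain ⟨U, hU⟩ : ∃ U, S.IsConvexOpenWitness U := by
    obtain ⟨U, h1, h2, h3⟩ := hS
    exact ⟨U, fun w => (h1 w).1, fun w => (h1 w).2.2.1, fun w => (h1 w).2.2.2, h2, h3⟩
  obtain ⟨U', hU'⟩ := hI.exists_witness
  have hF' := hK.toGraphDirected
  have hdeg' := hK.two_le_outDegree (hF.nontrivial hU hdeg u)
  obtain ⟨⟨_, hk0, k, rfl⟩, ⟨_, hm0, m, rfl⟩⟩ := hii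
  have huniv : ({e | e ∈ L} ∪ {e | e ∉ L} : Set E) = Set.univ :=
    Set.union_compl_self {e | e ∈ L}
  rw [huniv] at hiii
  have hL0 := fun a ha => (S.absRatios_pos_lt_one {e | e ∈ L} a ha).1
  have hLc := S.absRatios_pos_lt_one {e | e ∉ L}
  have hmixed (T : I) : |(I.toGraphDirected.sim T).ratio| ∈
      mixedPowers (S.absRatios {e | e ∈ L}) (S.absRatios {e | e ∉ L}) := by
    obtain ⟨p, hne, hp, hw⟩ := hF.exists_loop_weight hU hdeg hk0
      (fun x hx hx0 => hiii u x.1 k x.2 hx hx0) (I.toGraphDirected.sim T).abs_ratio_pos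
      (I.toGraphDirected.sim T).abs_ratio_lt_one
      fun t ht => hF'.mul_mem_gapLengths hU' hdeg' T ht
    rw [hw]
    refine S.weight_mem_mixedPowers (fun e _ => em _) ?_
    cases p with
    | nil => exact absurd rfl hne
    -- The first edge of a closed path at `u` starts at `u`, so it cannot belong to `L`.
    | cons e p => exact ⟨e, by simp, fun he => hu ⟨e, he, Or.inl hp.1⟩⟩
  obtain ⟨a, hLne, hLa⟩ := hL
  obtain ⟨l₁, l₂, hl, h1, h2⟩ := hLa.exists_split hv
  obtain ⟨q, -, hq⟩ := huv
  -- `L` need not start at `v`; its rotation `l₂ ++ l₁` does and has the same weight.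
  have hcirc (n : ℕ) : S.weight L ^ n * S.basicGap F v m ∈ gapLengths (F v) := by
    induction n with
    | zero => simpa using hF.basicGap_mem_gapLengths hU hdeg hm0
    | succ n ih =>
      have := hF.weight_mul_mem_gapLengths hU hdeg (h2.append h1) ih
      rwa [S.weight_append, mul_comm (S.weight l₂), ← S.weight_append, ← hl, ← mul_assoc,
        ← pow_succ'] at this
  choose p x _ hx hpx using fun n => hF'.exists_path_of_mem_gapLengths hU' hdeg' (w := ())
    (hF.weight_mul_mem_gapLengths hU hdeg hq (hcirc n))
  obtain ⟨i, j, hij, hc, hle⟩ := exists_lt_color_eq_count_le p x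
  obtain ⟨d, rfl⟩ := Nat.exists_eq_add_of_lt hij
  -- Dividing the two gap lengths cancels the weight of `q`, the gap at `v` and the common basic gap
  -- of the standard IFS. The natural subtraction in the exponents is exact by `hle`.
  have hquot : S.weight L ^ (d + 1) =
      ∏ T, |(I.toGraphDirected.sim T).ratio| ^ ((p (i + d + 1)).count T - (p i).count T) := by
    have e1 := hpx i
    have e2 := hpx (i + d + 1)
    rw [← hc] at e2
    refine mul_right_cancel₀ (mul_pos (I.toGraphDirected.weight_pos (p i)) (hx i)).ne' ?_
    have e3 : I.toGraphDirected.weight (p (i + d + 1)) =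
        (∏ T, |(I.toGraphDirected.sim T).ratio| ^
          ((p (i + d + 1)).count T - (p i).count T)) * I.toGraphDirected.weight (p i) := by
      rw [GraphDirectedIFS.weight_eq_prod, GraphDirectedIFS.weight_eq_prod,
        ← Finset.prod_mul_distrib]
      exact Finset.prod_congr rfl fun T _ => by rw [← pow_add, Nat.sub_add_cancel (hle T)]
    rw [← mul_assoc (∏ T, _), ← e3, ← e1, ← e2]
    ring
  have hlt : S.weight L ^ (d + 1) < 1 :=
    pow_lt_one₀ (S.weight_pos L).le (S.weight_lt_one hLne) (Nat.succ_ne_zero d)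
  have hmem := prod_pow_eq_one_or_mem_mixedPowers hL0 (fun b hb => (hLc b hb).1) hmixed
    (fun T => (p (i + d + 1)).count T - (p i).count T) Finset.univ
  rw [← hquot] at hmem
  -- The product is not the empty one, since it is less than `1`; so it is mixed, while a power of
  -- the weight of `L` lies in A(L)^ℚ.
  exact Set.disjoint_left.1 (disjoint_ratPowers_mixedPowers hL0 hLc hi)
    (ratPowers_pow hL0 (S.weight_mem_ratPowers fun _ he => he) (d + 1))
    (hmem.resolve_left hlt.ne)
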